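/- Let $k \le n$ be positive integers. Let $$I_{n,k} = \langle x_1^k, \dots, x_n^k,\ e_n(x_1,\dots,x_n),\ e_{n-1}(x_1,\dots,x_n),\ \dots,\ e_{n-k+1}(x_1,\dots,x_n) \rangle \subseteq \mathbb{Q}[x_1,\dots,x_n],$$ where $e_r$ is the elementary symmetric polynomial of degree $r$, and let $R_{n,k} = \mathbb{Q}[x_1,\dots,x_n]/I_{n,k}$, on which the symmetric group $\mathfrak{S}_n$ acts by permuting the variables, $w \cdot x_i = x_{w(i)}$. Let $\mathcal{OP}_{n,k}$ be the set of ordered set partitions $(B_1 \mid \cdots \mid B_k)$ of $\{1,\dots,n\}$ into $k$ nonempty blocks, on which $\mathfrak{S}_n$ acts by $w \cdot (B_1 \mid \cdots \mid B_k) = (w(B_1) \mid \cdots \mid w(B_k))$, and let $\mathbb{Q}[\mathcal{OP}_{n,k}]$ be the corresponding permutation representation. For a finite-dimensional $\mathbb{Q}$-representation $V$ of $\mathfrak{S}_n$ with character $\chi_V$, let $$\mathrm{Frob}(V) = \frac{1}{n!} \sum_{w \in \mathfrak{S}_n} \chi_V(w)\, p_{\mathrm{cyc}(w)}(\mathbf{x})$$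 be its Frobenius character, where $p_\mu$ denotes the power sum symmetric function in infinitely many variables $\mathbf{x}$ and $\mathrm{cyc}(w)$ is the cycle type of $w$ (thus $\mathrm{Frob}$ is additive on direct sums and sends the irreducible representation $S^\lambda$ to the Schur function $s_\lambda$). **Theorem.** As ungraded $\mathfrak{S}_n$-modules, $$R_{n,k} \cong \mathbb{Q}[\mathcal{OP}_{n,k}].$$ Equivalently, $$\mathrm{Frob}(R_{n,k}) = \sum_{\substack{\lambda \vdash n \\ \ell(\lambda) = k}} \frac{k!}{m_1(\lambda)!\, m_2(\lambda)! \cdots m_n(\lambda)!}\; h_\lambda(\mathbf{x}),$$ where the sum is over the partitions $\lambda$ of $n$ with exactly $k$ parts, $m_i(\lambda)$ is the number of parts of $\lambda$ equal to $i$, and $h_\lambda = \prod_i h_{\lambda_i}$ is the complete homogeneous symmetric function. -/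

import Mathlib

open scoped Nat

namespace GenCoinv

/-- An ordered set partition of `[n]` (modelled by `Fin n`) with `k` blocks: a sequence
`B_1 | B_2 | ... | B_k` of nonempty, pairwise disjoint subsets whose union is everything. -/
@[ext]
structure OrderedSetPartition (n k : ℕ) where
  block : Fin k → Finset (Fin n)
  nonempty : ∀ i, (block i).Nonempty
  disjoint : ∀ i j, i ≠ j → Disjoint (block i) (block j)
  cover : ∀ a : Fin n, ∃ i, a ∈ block i

namespace OrderedSetPartition

/-- The natural action of the symmetric group on ordered set partitions:
`w • (B_1 | ... | B_k) = (w(B_1) | ... | w(B_k))`. -/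
instance (n k : ℕ) : MulAction (Equiv.Perm (Fin n)) (OrderedSetPartition n k) where
  smul w σ :=
    { block := fun i => (σ.block i).map w.toEmbedding
      nonempty := fun i => (σ.nonempty i).map
      disjoint := fun i j h => (Finset.disjoint_map _).2 (σ.disjoint i j h)
      cover := fun a => by
        obtain ⟨i, hi⟩ := σ.cover (w.symm a)
        exact ⟨i, Finset.mem_map.2 ⟨w.symm a, hi, by simp⟩⟩ }
  one_smul σ := by
    ext i a
    change a ∈ (σ.block i).map _ ↔ _
    simp only [Finset.mem_map_equiv]
    rfl
  mul_smul v w σ := by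
    ext i a
    change a ∈ (σ.block i).map _ ↔ a ∈ ((σ.block i).map _).map _
    simp only [Finset.mem_map_equiv]
    rfl

theorem smul_block {n k : ℕ} (w : Equiv.Perm (Fin n)) (σ : OrderedSetPartition n k) (i : Fin k) :
    (w • σ).block i = (σ.block i).map w.toEmbedding := rfl

end OrderedSetPartition

/-- The ideal `I_{n,k}` of `ℚ[x_1, ..., x_n]` generated by `x_1^k, ..., x_n^k` and by the
elementary symmetric polynomials `e_r` with `n - k + 1 ≤ r ≤ n`. -/
noncomputable def idealI (n k : ℕ) : Ideal (MvPolynomial (Fin n) ℚ) :=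
  Ideal.span
    ({p | ∃ i : Fin n, p = MvPolynomial.X i ^ k} ∪
      {p | ∃ r : ℕ, n + 1 ≤ r + k ∧ r ≤ n ∧ p = MvPolynomial.esymm (Fin n) ℚ r})

/-- The ideal `I_{n,k}` is stable under permuting the variables. -/
theorem idealI_le_comap (n k : ℕ) (w : Equiv.Perm (Fin n)) :
    idealI n k ≤
      (idealI n k).comap (MvPolynomial.rename w : MvPolynomial (Fin n) ℚ →ₐ[ℚ] _) := by
  refine Ideal.span_le.2 ?_
  rintro p (⟨i, rfl⟩ | ⟨r, h1, h2, rfl⟩)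
  · refine Ideal.subset_span (Or.inl ⟨w i, ?_⟩)
    simp
  · refine Ideal.subset_span (Or.inr ⟨r, h1, h2, ?_⟩)
    exact MvPolynomial.rename_esymm (Fin n) ℚ r w

/-- The quotient ring `R_{n,k} = ℚ[x_1, ..., x_n] / I_{n,k}`. -/
abbrev RingR (n k : ℕ) : Type := MvPolynomial (Fin n) ℚ ⧸ idealI n k

/-- The representation of the symmetric group on `R_{n,k}` induced by the permutation of
variables `w . x_i = x_{w(i)}`. -/
noncomputable def repR (n k : ℕ) : Representation ℚ (Equiv.Perm (Fin n)) (RingR n k) where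
  toFun w :=
    (Ideal.quotientMapₐ (idealI n k)
      (MvPolynomial.rename w : MvPolynomial (Fin n) ℚ →ₐ[ℚ] _) (idealI_le_comap n k w)).toLinearMap
  map_one' := by
    refine LinearMap.ext fun x => ?_
    obtain ⟨p, rfl⟩ := Ideal.Quotient.mk_surjective x
    simp
  map_mul' v w := by
    refine LinearMap.ext fun x => ?_
    obtain ⟨p, rfl⟩ := Ideal.Quotient.mk_surjective x
    simp [MvPolynomial.rename_rename]

theorem repR_mk (n k : ℕ) (w : Equiv.Perm (Fin n)) (p : MvPolynomial (Fin n) ℚ) :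
    repR n k w (Ideal.Quotient.mk (idealI n k) p) =
      Ideal.Quotient.mk (idealI n k) (MvPolynomial.rename w p) := by
  simp [repR]

/-! Symmetric functions in infinitely many variables are regarded as elements of the ring of formal
power series in the variables `x_0, x_1, x_2, ...` with rational coefficients. -/

/-- The power sum `p_d = x_0^d + x_1^d + ...` (for `1 ≤ d`). -/
noncomputable def powerSum (d : ℕ) : MvPowerSeries ℕ ℚ :=
  open Classical in fun a => if ∃ i : ℕ, a = Finsupp.single i d then 1 else 0

/-- The complete homogeneous symmetric function `h_d`: the sum of all monomials of degree `d`. -/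
noncomputable def completeHomogeneous (d : ℕ) : MvPowerSeries ℕ ℚ :=
  fun a => if a.degree = d then 1 else 0

/-- `h_μ = h_{μ_1} h_{μ_2} ...` for a partition `μ`. -/
noncomputable def completeHomogeneousPart {n : ℕ} (μ : n.Partition) : MvPowerSeries ℕ ℚ :=
  (μ.parts.map completeHomogeneous).prod

/-- `p_{cyc(w)}`: the product of the power sums `p_c` over the lengths `c` of all the cycles of `w`,
fixed points included as cycles of length one. -/
noncomputable def powerSumCycle {n : ℕ} (w : Equiv.Perm (Fin n)) : MvPowerSeries ℕ ℚ :=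
  (w.partition.parts.map powerSum).prod

/-- The Frobenius character (Frobenius characteristic) of a finite-dimensional representation `V` of
the symmetric group with character `χ`: `Frob(V) = (1 / n!) ∑_w χ(w) p_{cyc(w)}`. -/
noncomputable def frob {n : ℕ} {V : Type*} [AddCommGroup V] [Module ℚ V]
    (ρ : Representation ℚ (Equiv.Perm (Fin n)) V) : MvPowerSeries ℕ ℚ :=
  (n ! : ℚ)⁻¹ • ∑ w : Equiv.Perm (Fin n), ρ.character w • powerSumCycle w

end GenCoinv

/-! Orbit harmonics. Attach to each surjection `f : [n] → [k]` the point `(f(1), ..., f(n))`, with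
values taken in `{0, ..., k-1}`. These points form an `S_n`-set isomorphic to the ordered set
partitions. Every generator of `I_{n,k}` is the top-degree part of a polynomial vanishing on all of
them, so `I_{n,k}` lies in the ideal of leading forms of the vanishing ideal
(`exists_mem_vanishingIdeal_sub_homogeneousComponent`).

Let `p` be an equivariant projection onto `I_{n,k}` that does not raise degrees. Then evaluation
composed with `1 - p` kills `I_{n,k}`, and by induction on degree it is still onto
(`exists_equivariant_surjection`). Hence `R_{n,k}` surjects equivariantly onto `ℚ[OP_{n,k}]`.

Conversely, filtering by powers of the first variable yields a spanning set of `R_{n,k}` whose size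
obeys the recursion that counts surjections (`exists_finset_span_sup_idealJ`,
`card_cover_eq_coverCount`). The dimensions therefore agree and the surjection is an isomorphism.

For the Frobenius character, the coefficient of `x^a` is an average of products of fixed-point
counts, on ordered set partitions and on words of content `a`. By Burnside it counts orbits of
pairs, which are the sequences of `k` nonzero exponent vectors with sum `a`. The same number is the
coefficient of `x^a` in `(h_1 + ... + h_n)^k` when `a` has degree `n`, and the multinomial theorem
expands this power into the `h_λ`. -/

namespace GenCoinv
-- Upper bound for the dimension of the quotient.
open MvPolynomial

/-- The ideal generated by the `k`-th powers of the variables and by the elementary symmetric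
polynomials `e_r` with `n - s + 1 ≤ r`. -/
noncomputable def idealJ (n k s : ℕ) : Ideal (MvPolynomial (Fin n) ℚ) :=
  Ideal.span ({p | ∃ i : Fin n, p = X i ^ k} ∪ {p | ∃ r : ℕ, n + 1 ≤ r + s ∧ p = esymm (Fin n) ℚ r})

theorem X_pow_mem_idealJ {n k s : ℕ} (i : Fin n) : X i ^ k ∈ idealJ n k s :=
  Ideal.subset_span (Or.inl ⟨i, rfl⟩)

theorem esymm_mem_idealJ {n k s r : ℕ} (h : n + 1 ≤ r + s) : esymm (Fin n) ℚ r ∈ idealJ n k s :=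
  Ideal.subset_span (Or.inr ⟨r, h, rfl⟩)

theorem esymm_eq_zero {n r : ℕ} (h : n < r) : esymm (Fin n) ℚ r = 0 := by
  rw [esymm, Finset.powersetCard_eq_empty.2 (by simpa using h), Finset.sum_empty]

theorem idealJ_le_idealI (n k : ℕ) : idealJ n k k ≤ idealI n k := by
  refine Ideal.span_le.2 ?_
  rintro p (⟨i, rfl⟩ | ⟨r, h, rfl⟩)
  · exact Ideal.subset_span (Or.inl ⟨i, rfl⟩)
  · rcases le_or_gt r n with hr | hr
    · exact Ideal.subset_span (Or.inr ⟨r, h, hr, rfl⟩)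
    · simp [esymm_eq_zero hr]

theorem esymm_fin_succ (n r : ℕ) :
    esymm (Fin (n + 1)) ℚ (r + 1) =
      rename Fin.succ (esymm (Fin n) ℚ (r + 1)) + X 0 * rename Fin.succ (esymm (Fin n) ℚ r) := by
  simp only [esymm_eq_multiset_esymm, Multiset.esymm]
  have h : (Finset.univ : Finset (Fin (n + 1))).val.map (X : _ → MvPolynomial (Fin (n + 1)) ℚ) =
      X 0 ::ₘ ((Finset.univ : Finset (Fin n)).val.map X).map (rename Fin.succ) := by
    rw [Fin.univ_succ]
    simp [Function.comp_def]
  rw [h, Multiset.powersetCard_cons, Multiset.map_add, Multiset.sum_add]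
  simp only [Multiset.powersetCard_map, Multiset.map_map, Function.comp_def, Multiset.prod_cons, map_multiset_sum,
    map_multiset_prod, Multiset.sum_map_mul_left]

theorem exists_eq_rename_succ_add {n : ℕ} (f : MvPolynomial (Fin (n + 1)) ℚ) :
    ∃ (f' : MvPolynomial (Fin n) ℚ) (g : MvPolynomial (Fin (n + 1)) ℚ),
      f = rename Fin.succ f' + X 0 * g := by
  induction f using MvPolynomial.induction_on with
  | C a => exact ⟨C a, 0, by simp⟩
  | add p q hp hq =>
    obtain ⟨p', g, hp⟩ := hp
    obtain ⟨q', g', hq⟩ := hq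
    exact ⟨p' + q', g + g', by rw [hp, hq, map_add]; ring⟩
  | mul_X p i hp =>
    obtain ⟨p', g, hp⟩ := hp
    refine Fin.cases ⟨0, p, by simp [mul_comm]⟩ (fun j => ⟨p' * X j, g * X j.succ, ?_⟩) i
    rw [hp, map_mul, rename_X]; ring

/-- Since `e_{r+1}(all) = e_{r+1}(rest) + x_0 e_r(rest)`, modulo the ideal each factor `x_0` can be
traded, up to sign, for raising the index by one. The chain ends at `e_{n+1}(rest) = 0`. -/
theorem X_zero_pow_mul_esymm_mem {n k s : ℕ} (t r : ℕ) (hts : t ≤ s) (htr : r + t = n + 1) :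
    X 0 ^ t * rename Fin.succ (esymm (Fin n) ℚ r) ∈ idealJ (n + 1) k s := by
  induction t generalizing r with
  | zero => simp [esymm_eq_zero (show n < r by omega)]
  | succ t ih =>
    have h1 := ih (r + 1) (by omega) (by omega)
    have h2 : esymm (Fin (n + 1)) ℚ (r + 1) ∈ idealJ (n + 1) k s := esymm_mem_idealJ (by omega)
    have h3 := (idealJ (n + 1) k s).sub_mem (Ideal.mul_mem_left _ (X 0 ^ t) h2) h1
    rw [esymm_fin_succ] at h3
    convert h3 using 1
    ring

/-- Modulo `x_0^{i+1}`, the products of `x_0^i` with `e_r(rest)` and with `e_r(all)` coincide. This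
is why the `i`-th layer of the filtration by powers of `x_0` is controlled by the same kind of ideal
in one variable fewer. -/
theorem X_zero_pow_mul_rename_mem {n k s s' i : ℕ} (hs : s' + 1 = s ∨ s' = s ∧ s ≤ i)
    {p : MvPolynomial (Fin n) ℚ} (hp : p ∈ idealJ n k s') :
    X 0 ^ i * rename Fin.succ p ∈ idealJ (n + 1) k s ⊔ Ideal.span {X 0 ^ (i + 1)} := by
  have key : ∀ r, n + 2 ≤ r + s → X 0 ^ i * rename Fin.succ (esymm (Fin n) ℚ r) ∈
      idealJ (n + 1) k s ⊔ Ideal.span {X 0 ^ (i + 1)} := by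
    intro r hr
    have h1 : esymm (Fin (n + 1)) ℚ r ∈ idealJ (n + 1) k s := esymm_mem_idealJ (by omega)
    cases r with
    | zero =>
      refine Ideal.mem_sup_left (Ideal.mul_mem_left _ _ ?_)
      simpa using h1
    | succ r =>
      have h2 : X 0 ^ i * rename Fin.succ (esymm (Fin n) ℚ (r + 1)) =
          X 0 ^ i * esymm (Fin (n + 1)) ℚ (r + 1) +
            - rename Fin.succ (esymm (Fin n) ℚ r) * X 0 ^ (i + 1) := by
        rw [esymm_fin_succ]; ring
      rw [h2]
      exact Ideal.add_mem _ (Ideal.mem_sup_left (Ideal.mul_mem_left _ _ h1))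
        (Ideal.mem_sup_right (Ideal.mul_mem_left _ _ (Ideal.mem_span_singleton_self _)))
  refine Submodule.span_induction ?_ ?_ ?_ ?_ hp
  · rintro p (⟨j, rfl⟩ | ⟨r, h, rfl⟩)
    · rw [map_pow, rename_X]
      exact Ideal.mem_sup_left (Ideal.mul_mem_left _ _ (X_pow_mem_idealJ _))
    · by_cases hr : n + 2 ≤ r + s
      · exact key r hr
      -- Only `r = n + 1 - s` with `s' = s` is left, and there `x_0^s` already multiplies
      -- `e_r(rest)` into the ideal.
      · clear key
        obtain ⟨rfl, hi⟩ : s' = s ∧ s ≤ i := by omega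
        obtain ⟨c, rfl⟩ := Nat.exists_eq_add_of_le' hi
        have h := Ideal.mul_mem_left _ (X 0 ^ c)
          (X_zero_pow_mul_esymm_mem (n := n) (k := k) s' r le_rfl (by omega))
        rw [← mul_assoc, ← pow_add] at h
        exact Ideal.mem_sup_left h
  · simp
  · intro x y _ _ hx hy
    rw [map_add, mul_add]
    exact Ideal.add_mem _ hx hy
  · intro a x _ hx
    rw [smul_eq_mul, map_mul, mul_left_comm]
    exact Ideal.mul_mem_left _ _ hx

/-- The number of functions from `[n]` to `[k]` whose image contains `s` prescribed elements,
defined by recursion on `n`. -/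
def coverCount : ℕ → ℕ → ℕ → ℕ
  | 0, _, s => if s = 0 then 1 else 0
  | n + 1, k, s => ∑ i ∈ Finset.range k, if i < s then coverCount n k (s - 1) else coverCount n k s

/-- The layers `x_0^i`, `i < k`, exhaust the quotient because `x_0^k` lies in the ideal. Layer `i`
is spanned by `x_0^i` times a spanning set for `n` variables, with parameter `s - 1` or `s`
according to whether `i < s`. -/
theorem exists_finset_span_sup_idealJ (n k s : ℕ) :
    ∃ T : Finset (MvPolynomial (Fin n) ℚ), T.card ≤ coverCount n k s ∧
      ∀ f, f ∈ Submodule.span ℚ (T : Set (MvPolynomial (Fin n) ℚ)) ⊔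
        (idealJ n k s).restrictScalars ℚ := by
  classical
  induction n generalizing s with
  | zero =>
    by_cases hs : s = 0
    · refine ⟨{1}, by simp [coverCount, hs], fun f => Submodule.mem_sup_left ?_⟩
      rw [Finset.coe_singleton, Submodule.mem_span_singleton]
      refine ⟨coeff 0 f, ?_⟩
      rw [eq_C_of_isEmpty f]
      simp [smul_eq_C_mul]
    · refine ⟨∅, by simp, fun f => Submodule.mem_sup_right ?_⟩
      -- With `s > 0` the generators include `e_0 = 1`.
      have h : esymm (Fin 0) ℚ 0 ∈ idealJ 0 k s := esymm_mem_idealJ (by omega)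
      rw [esymm_zero] at h
      exact (Ideal.eq_top_iff_one _).2 h ▸ Submodule.mem_top
  | succ n ih =>
    choose T hT hspan using ih
    let c : ℕ → ℕ := fun i => if i < s then s - 1 else s
    let U : Finset (MvPolynomial (Fin (n + 1)) ℚ) := (Finset.range k).biUnion fun i =>
      (T (c i)).image fun p => X 0 ^ i * rename Fin.succ p
    refine ⟨U, ?_, ?_⟩
    · refine Finset.card_biUnion_le.trans (Finset.sum_le_sum fun i _ => ?_)
      refine Finset.card_image_le.trans ((hT _).trans (le_of_eq ?_))
      simp only [c]
      split_ifs <;> rfl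
    -- Descending induction on the exponent `i`, starting from `i = k`.
    · have key : ∀ j i, i + j = k → ∀ f : MvPolynomial (Fin (n + 1)) ℚ, X 0 ^ i * f ∈
          Submodule.span ℚ (U : Set (MvPolynomial (Fin (n + 1)) ℚ)) ⊔
            (idealJ (n + 1) k s).restrictScalars ℚ := by
        intro j
        induction j with
        | zero =>
          rintro i rfl f
          exact Submodule.mem_sup_right (Ideal.mul_mem_right _ _ (X_pow_mem_idealJ _))
        | succ j ihj =>
          intro i hi f
          have ihj := ihj (i + 1) (by omega)
          obtain ⟨f', g, rfl⟩ := exists_eq_rename_succ_add f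
          have hg : X 0 ^ i * (rename Fin.succ f' + X 0 * g) =
              X 0 ^ i * rename Fin.succ f' + X 0 ^ (i + 1) * g := by ring
          rw [hg]
          clear hg
          refine Submodule.add_mem _ ?_ (ihj g)
          obtain ⟨u, hu, v, hv, rfl⟩ := Submodule.mem_sup.1 (hspan (c i) f')
          rw [map_add, mul_add]
          refine Submodule.add_mem _ (Submodule.mem_sup_left ?_) ?_
          · induction hu using Submodule.span_induction with
            | mem x hx =>
              refine Submodule.subset_span ?_
              simp only [U, Finset.coe_biUnion, Set.mem_iUnion, Finset.coe_image]
              exact ⟨i, by simp; omega, x, hx, rfl⟩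
            | zero => simp
            | add x y _ _ hx hy => rw [map_add, mul_add]; exact Submodule.add_mem _ hx hy
            | smul a x _ hx =>
              rw [map_smul, mul_smul_comm]; exact Submodule.smul_mem _ _ hx
          · have h := X_zero_pow_mul_rename_mem (s := s) (i := i) (by grind) hv
            obtain ⟨y, hy, z, hz, h⟩ := Submodule.mem_sup.1 h
            obtain ⟨z, rfl⟩ := Ideal.mem_span_singleton.1 hz
            rw [← h]
            exact Submodule.add_mem _ (Submodule.mem_sup_right hy) (ihj z)
      intro f
      simpa using key k 0 (by simp) f

/-- Condition on `a = f 0`: the remaining values must cover `S.erase a`, which is smaller than `S`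
for exactly `S.card` choices of `a`. -/
theorem card_cover_eq_coverCount (n k : ℕ) (S : Finset (Fin k)) :
    Nat.card {f : Fin n → Fin k // ∀ j ∈ S, ∃ i, f i = j} = coverCount n k S.card := by
  classical
  induction n generalizing S with
  | zero =>
    rw [coverCount]
    split_ifs with h
    · rw [Finset.card_eq_zero] at h
      subst h
      simp
    · obtain ⟨j, hj⟩ := Finset.card_ne_zero.1 h
      rw [Nat.card_eq_zero]
      exact Or.inl ⟨fun f => by obtain ⟨i, _⟩ := f.2 j hj; exact i.elim0⟩
  | succ n ih =>
    have e : {f : Fin (n + 1) → Fin k // ∀ j ∈ S, ∃ i, f i = j} ≃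
        Σ a : Fin k, {f : Fin n → Fin k // ∀ j ∈ S.erase a, ∃ i, f i = j} :=
      { toFun := fun f => ⟨f.1 0, fun i => f.1 i.succ, fun j hj => by
          obtain ⟨i, hi⟩ := f.2 j (Finset.mem_of_mem_erase hj)
          induction i using Fin.cases with
          | zero => exact absurd hi.symm (Finset.ne_of_mem_erase hj)
          | succ i => exact ⟨i, hi⟩⟩
        invFun := fun f => ⟨Fin.cons f.1 f.2.1, fun j hj => by
          by_cases h : j = f.1
          · exact ⟨0, by simp [h]⟩
          · obtain ⟨i, hi⟩ := f.2.2 j (Finset.mem_erase.2 ⟨h, hj⟩)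
            exact ⟨i.succ, by simpa using hi⟩⟩
        left_inv := fun f => by
          ext i
          induction i using Fin.cases <;> simp
        right_inv := fun _ => rfl }
    rw [Nat.card_congr e, Nat.card_sigma, coverCount]
    simp only [ih, Finset.card_erase_eq_ite]
    have h : ∀ a b : ℕ, (∑ x : Fin k, if x ∈ S then a else b) =
        ∑ i ∈ Finset.range k, if i < S.card then a else b := by
      intro a b
      have hS : S.card ≤ k := by simpa using S.card_le_univ
      rw [Finset.sum_ite, Finset.sum_ite, Finset.sum_const, Finset.sum_const, Finset.sum_const,
        Finset.sum_const, Finset.filter_mem_eq_inter, Finset.univ_inter, Finset.filter_not,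
        Finset.filter_mem_eq_inter, Finset.univ_inter, Finset.filter_not,
        Finset.card_sdiff_of_subset (Finset.subset_univ _),
        Finset.card_sdiff_of_subset (Finset.filter_subset _ _)]
      have : Finset.filter (fun i => i < S.card) (Finset.range k) = Finset.range S.card := by
        ext i; simp; omega
      rw [this]
      simp
    rw [← h]
    exact Finset.sum_congr rfl fun x _ => by split_ifs <;> rfl

theorem card_surjective_eq_coverCount (n k : ℕ) :
    Nat.card {f : Fin n → Fin k // Function.Surjective f} = coverCount n k k := by
  have h := card_cover_eq_coverCount n k Finset.univ
  simpa [Function.Surjective] using h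

theorem finite_and_finrank_ringR_le (n k : ℕ) :
    Module.Finite ℚ (RingR n k) ∧
      Module.finrank ℚ (RingR n k) ≤ Nat.card {f : Fin n → Fin k // Function.Surjective f} := by
  classical
  obtain ⟨T, hT, hspan⟩ := exists_finset_span_sup_idealJ n k k
  let q : MvPolynomial (Fin n) ℚ →ₗ[ℚ] RingR n k := (Ideal.Quotient.mkₐ ℚ (idealI n k)).toLinearMap
  have htop : Submodule.span ℚ ((T.image q : Finset (RingR n k)) : Set (RingR n k)) = ⊤ := by
    rw [eq_top_iff]
    rintro x -
    obtain ⟨f, rfl⟩ := Ideal.Quotient.mk_surjective x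
    obtain ⟨u, hu, v, hv, rfl⟩ := Submodule.mem_sup.1 (hspan f)
    rw [map_add, Ideal.Quotient.eq_zero_iff_mem.2 (idealJ_le_idealI n k hv), add_zero,
      Finset.coe_image, Submodule.span_image]
    exact ⟨u, hu, rfl⟩
  refine ⟨⟨_, htop⟩, ?_⟩
  rw [card_surjective_eq_coverCount, ← finrank_top ℚ (RingR n k), ← htop]
  exact (finrank_span_finset_le_card _).trans (Finset.card_image_le.trans hT)

end GenCoinv

/-! ### Leading forms of polynomials vanishing at the surjection points. -/

namespace GenCoinv
open MvPolynomial

/-- The polynomials all of whose monomials have degree less than `d`. -/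
def degreeLT (n d : ℕ) : Submodule ℚ (MvPolynomial (Fin n) ℚ) where
  carrier := {f | ∀ m, coeff m f ≠ 0 → m.degree < d}
  zero_mem' m h := absurd (coeff_zero m) h
  add_mem' {f g} hf hg m h := by
    by_cases h1 : coeff m f = 0
    · exact hg m fun h2 => h (by rw [coeff_add, h1, h2, add_zero])
    · exact hf m h1
  smul_mem' c f hf m h := hf m fun h1 => h (by rw [coeff_smul, h1, smul_zero])

theorem degreeLT_zero {n : ℕ} {f : MvPolynomial (Fin n) ℚ} (hf : f ∈ degreeLT n 0) : f = 0 := by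
  ext m
  by_contra h
  exact absurd (hf m h) (by simp)

theorem degreeLT_mono {n d e : ℕ} (h : d ≤ e) : degreeLT n d ≤ degreeLT n e :=
  fun _ hf m hm => (hf m hm).trans_le h

theorem mem_degreeLT_totalDegree_succ {n : ℕ} (f : MvPolynomial (Fin n) ℚ) :
    f ∈ degreeLT n (f.totalDegree + 1) := fun m hm =>
  Nat.lt_succ_of_le (by
    have h := le_totalDegree (mem_support_iff.2 hm)
    exact h)

theorem IsHomogeneous.mem_degreeLT {n d e : ℕ} {f : MvPolynomial (Fin n) ℚ}
    (hf : f.IsHomogeneous e) (h : e < d) : f ∈ degreeLT n d := fun m hm => by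
  by_contra h1
  exact hm (hf.coeff_eq_zero (by omega))

theorem C_mul_mem_degreeLT {n d : ℕ} (c : ℚ) {f : MvPolynomial (Fin n) ℚ}
    (hf : f ∈ degreeLT n d) : C c * f ∈ degreeLT n d := by
  rw [← smul_eq_C_mul]
  exact Submodule.smul_mem _ _ hf

theorem X_mul_mem_degreeLT {n d : ℕ} (i : Fin n) {f : MvPolynomial (Fin n) ℚ}
    (hf : f ∈ degreeLT n d) : X i * f ∈ degreeLT n (d + 1) := fun m hm => by
  classical
  rw [coeff_X_mul'] at hm
  split_ifs at hm with hi
  · have h := hf _ hm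
    have h1 : Finsupp.single i 1 ≤ m := by
      rw [Finsupp.single_le_iff]
      exact Nat.one_le_iff_ne_zero.2 (Finsupp.mem_support_iff.1 hi)
    rw [← tsub_add_cancel_of_le h1, map_add, Finsupp.degree_single]
    omega
  · exact absurd rfl hm

theorem rename_mem_degreeLT {n d : ℕ} (w : Equiv.Perm (Fin n)) {f : MvPolynomial (Fin n) ℚ}
    (hf : f ∈ degreeLT n d) : rename w f ∈ degreeLT n d := fun m hm => by
  obtain ⟨u, rfl, hu⟩ := coeff_rename_ne_zero _ _ _ hm
  have h := hf u hu
  rwa [Finsupp.degree_mapDomain]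

theorem sub_homogeneousComponent_mem_degreeLT {n d : ℕ} {f : MvPolynomial (Fin n) ℚ}
    (hf : f ∈ degreeLT n (d + 1)) : f - homogeneousComponent d f ∈ degreeLT n d := fun m hm => by
  rw [coeff_sub, coeff_homogeneousComponent] at hm
  split_ifs at hm with h
  · simp at hm
  · rw [sub_zero] at hm
    have := hf m hm
    omega

theorem homogeneousComponent_succ_X_mul {n : ℕ} (d : ℕ) (i : Fin n) (f : MvPolynomial (Fin n) ℚ) :
    homogeneousComponent (d + 1) (X i * f) = X i * homogeneousComponent d f := by
  classical
  ext m
  rw [coeff_homogeneousComponent, coeff_X_mul', coeff_X_mul', coeff_homogeneousComponent]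
  by_cases hi : i ∈ m.support
  · have h1 : Finsupp.single i 1 ≤ m := by
      rw [Finsupp.single_le_iff]
      exact Nat.one_le_iff_ne_zero.2 (Finsupp.mem_support_iff.1 hi)
    have h2 : m.degree = (m - Finsupp.single i 1).degree + 1 := by
      conv_lhs => rw [← tsub_add_cancel_of_le h1, map_add, Finsupp.degree_single]
    simp [hi, h2]
  · simp [hi]

/-- The point of `ℚ^n` with integral coordinates attached to a function `[n] → [k]`. -/
def point {n k : ℕ} (f : Fin n → Fin k) (i : Fin n) : ℚ := ((f i : ℕ) : ℚ)

/-- The ideal of the polynomials that vanish at the points attached to surjections `[n] → [k]`. -/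
def vanishingIdeal (n k : ℕ) : Ideal (MvPolynomial (Fin n) ℚ) where
  carrier := {p | ∀ f : Fin n → Fin k, Function.Surjective f → eval (point f) p = 0}
  zero_mem' f _ := map_zero _
  add_mem' hp hq f hf := by rw [map_add, hp f hf, hq f hf, add_zero]
  smul_mem' c p hp f hf := by rw [smul_eq_mul, map_mul, hp f hf, mul_zero]

/-- The coordinates of a point lie in `{0, ..., k-1}`, so `x_i (x_i - 1) ⋯ (x_i - k + 1)` vanishes
there. -/
theorem exists_mem_vanishingIdeal_sub_X_pow {n : ℕ} (k : ℕ) (i : Fin n) :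
    ∃ g ∈ vanishingIdeal n k, g - X i ^ k ∈ degreeLT n k := by
  refine ⟨∏ j ∈ Finset.range k, (X i - C (j : ℚ)), ?_, ?_⟩
  · intro f _
    rw [map_prod]
    refine Finset.prod_eq_zero (Finset.mem_range.2 (f i).2) ?_
    simp [point]
  · induction k with
    | zero => simp
    | succ k ih =>
      rw [Finset.prod_range_succ]
      have h : (∏ j ∈ Finset.range k, (X i - C (j : ℚ))) * (X i - C (k : ℚ)) - X i ^ (k + 1) =
          X i * (∏ j ∈ Finset.range k, (X i - C (j : ℚ)) - X i ^ k) -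
            (C (k : ℚ) * (∏ j ∈ Finset.range k, (X i - C (j : ℚ)) - X i ^ k) +
              C (k : ℚ) * X i ^ k) := by ring
      rw [h]
      refine Submodule.sub_mem _ (X_mul_mem_degreeLT _ ih) (Submodule.add_mem _ ?_ ?_)
      · exact C_mul_mem_degreeLT _ (degreeLT_mono (Nat.le_succ _) ih)
      · exact C_mul_mem_degreeLT _
          (IsHomogeneous.mem_degreeLT (isHomogeneous_X_pow i k) (Nat.lt_succ_self _))

theorem coeff_prod_one_add {n : ℕ} (x : Fin n → ℚ) (a : ℕ) :
    (∏ i, (1 + Polynomial.C (x i) * Polynomial.X)).coeff a = eval x (esymm (Fin n) ℚ a) := by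
  rw [Finset.prod_one_add, Polynomial.finsetSum_coeff, esymm, map_sum]
  simp only [Finset.prod_mul_distrib, Finset.prod_const, ← map_prod, Polynomial.coeff_C_mul_X_pow]
  rw [← Finset.sum_filter, Finset.powersetCard_eq_filter]
  refine Finset.sum_congr ?_ fun s _ => by simp
  ext s
  simp [eq_comm]

/-- The inverse of the power series `∏ (1 + j t)`, where `j` runs over the coordinates of points. -/
noncomputable def invSeries (k : ℕ) : PowerSeries ℚ :=
  (((∏ j : Fin k, (1 + Polynomial.C ((j : ℕ) : ℚ) * Polynomial.X) : Polynomial ℚ)) :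
    PowerSeries ℚ)⁻¹

theorem constantCoeff_prod_one_add (k : ℕ) :
    PowerSeries.constantCoeff (((∏ j : Fin k,
      (1 + Polynomial.C ((j : ℕ) : ℚ) * Polynomial.X) : Polynomial ℚ)) : PowerSeries ℚ) = 1 := by
  rw [← PowerSeries.coeff_zero_eq_constantCoeff_apply, Polynomial.coeff_coe,
    Polynomial.coeff_zero_eq_eval_zero, Polynomial.eval_prod]
  simp

/-- For surjective `f` the product `∏ (1 + f(i) t)` is divisible by `∏_{j<k} (1 + j t)`. The
quotient is a polynomial of degree at most `n - k`, so its coefficient at `t^r` is zero. -/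
theorem sum_eval_esymm_mul_invSeries {n k r : ℕ} (f : Fin n → Fin k) (hf : Function.Surjective f)
    (hr : n + 1 ≤ r + k) :
    ∑ p ∈ Finset.HasAntidiagonal.antidiagonal r,
      eval (point f) (esymm (Fin n) ℚ p.1) * PowerSeries.coeff p.2 (invSeries k) = 0 := by
  classical
  set F : Fin n → Polynomial ℚ := fun i => 1 + Polynomial.C (point f i) * Polynomial.X with hF
  set D : Polynomial ℚ := ∏ j : Fin k, (1 + Polynomial.C ((j : ℕ) : ℚ) * Polynomial.X) with hD
  -- One preimage of each value: the factors over `S` multiply to `D`, those over the complement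
  -- form the quotient.
  let g := Function.surjInv hf
  have hg : Function.Injective g := Function.injective_surjInv hf
  let S : Finset (Fin n) := Finset.univ.image g
  have hS : S.card = k := by simp [S, Finset.card_image_of_injective _ hg]
  have h1 : ∏ i, F i = D * ∏ i ∈ Sᶜ, F i := by
    rw [← Finset.prod_mul_prod_compl S F]
    congr 1
    rw [Finset.prod_image fun a _ b _ h => hg h]
    refine Finset.prod_congr rfl fun j _ => ?_
    simp only [hF, point, g, Function.surjInv_eq hf]
  have h2 : ((∏ i, F i : Polynomial ℚ) : PowerSeries ℚ) * invSeries k =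
      ((∏ i ∈ Sᶜ, F i : Polynomial ℚ) : PowerSeries ℚ) := by
    rw [h1, Polynomial.coe_mul, mul_comm, ← mul_assoc, invSeries, PowerSeries.inv_mul_cancel,
      one_mul]
    rw [constantCoeff_prod_one_add]
    exact one_ne_zero
  have h3 := congrArg (PowerSeries.coeff r) h2
  rw [PowerSeries.coeff_mul, Polynomial.coeff_coe, Polynomial.coeff_eq_zero_of_natDegree_lt] at h3
  · simpa only [Polynomial.coeff_coe, hF, coeff_prod_one_add] using h3
  · have h4 : (∏ i ∈ Sᶜ, F i).natDegree ≤ ∑ i ∈ Sᶜ, 1 :=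
      (Polynomial.natDegree_prod_le _ _).trans (Finset.sum_le_sum fun i _ => by
        simp only [hF]
        compute_degree)
    have h5 : k ≤ n := by simpa [hS] using S.card_le_univ
    rw [Finset.sum_const, Finset.card_compl, hS, Fintype.card_fin, smul_eq_mul, mul_one] at h4
    omega

theorem isHomogeneous_esymm (n r : ℕ) : (esymm (Fin n) ℚ r).IsHomogeneous r := by
  refine IsHomogeneous.sum _ _ _ fun s hs => ?_
  have h := IsHomogeneous.prod s (fun i => (X i : MvPolynomial (Fin n) ℚ)) (fun _ => 1)
    fun i _ => isHomogeneous_X _ i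
  rwa [Finset.sum_const, (Finset.mem_powersetCard.1 hs).2, smul_eq_mul, mul_one] at h

/-- The inverse series has constant term 1, so the vanishing combination above is `e_r` plus
multiples of `e_j` with `j < r`. -/
theorem exists_mem_vanishingIdeal_sub_esymm {n k r : ℕ} (hr : n + 1 ≤ r + k) :
    ∃ g ∈ vanishingIdeal n k, g - esymm (Fin n) ℚ r ∈ degreeLT n r := by
  refine ⟨∑ p ∈ Finset.HasAntidiagonal.antidiagonal r,
    C (PowerSeries.coeff p.2 (invSeries k)) * esymm (Fin n) ℚ p.1, ?_, ?_⟩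
  · intro f hf
    rw [map_sum, ← sum_eval_esymm_mul_invSeries f hf hr]
    refine Finset.sum_congr rfl fun p _ => ?_
    rw [map_mul, eval_C, mul_comm]
  · have h0 : PowerSeries.coeff 0 (invSeries k) = 1 := by
      rw [PowerSeries.coeff_zero_eq_constantCoeff_apply, invSeries, PowerSeries.constantCoeff_inv,
        constantCoeff_prod_one_add, inv_one]
    have hmem : (r, 0) ∈ Finset.HasAntidiagonal.antidiagonal r := by simp
    rw [← Finset.add_sum_erase _ _ hmem, h0, C_1, one_mul, add_sub_cancel_left]
    refine Submodule.sum_mem _ fun p hp => C_mul_mem_degreeLT _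
      (IsHomogeneous.mem_degreeLT (isHomogeneous_esymm n p.1) ?_)
    rw [Finset.mem_erase, Finset.HasAntidiagonal.mem_antidiagonal] at hp
    have h2 : p.2 ≠ 0 := fun h => hp.1 (Prod.ext (by have := hp.2; simp; omega) h)
    omega

theorem homogeneousComponent_mem_idealI {n k : ℕ} {p : MvPolynomial (Fin n) ℚ}
    (hp : p ∈ idealI n k) (d : ℕ) : homogeneousComponent d p ∈ idealI n k := by
  let _ : GradedAlgebra (homogeneousSubmodule (Fin n) ℚ) := MvPolynomial.gradedAlgebra
  refine homogeneousComponent_mem_of_mem ?_ hp d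
  refine Ideal.homogeneous_span _ _ ?_
  rintro p (⟨i, rfl⟩ | ⟨r, _, _, rfl⟩)
  · exact ⟨k, isHomogeneous_X_pow i k⟩
  · exact ⟨r, isHomogeneous_esymm n r⟩

/-- Leading forms of an ideal are closed under multiplication by variables, which shifts degree by
one. Working one component at a time makes the property additive even when top terms cancel. -/
theorem exists_mem_vanishingIdeal_sub_homogeneousComponent {n k : ℕ} {p : MvPolynomial (Fin n) ℚ}
    (hp : p ∈ idealI n k) (d : ℕ) :
    ∃ g ∈ vanishingIdeal n k, g - homogeneousComponent d p ∈ degreeLT n d := by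
  have key : ∀ (e : ℕ) (p : MvPolynomial (Fin n) ℚ), p.IsHomogeneous e →
      (∃ g ∈ vanishingIdeal n k, g - p ∈ degreeLT n e) →
      ∀ d, ∃ g ∈ vanishingIdeal n k, g - homogeneousComponent d p ∈ degreeLT n d := by
    rintro e p hp ⟨g, hg, h⟩ d
    rw [homogeneousComponent_of_mem hp]
    split_ifs with hd
    · exact ⟨g, hg, hd ▸ h⟩
    · exact ⟨0, zero_mem _, by simp⟩
  induction hp using Submodule.span_induction generalizing d with
  | mem p hp =>
    rcases hp with ⟨i, rfl⟩ | ⟨r, h, _, rfl⟩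
    · exact key k _ (isHomogeneous_X_pow i k) (exists_mem_vanishingIdeal_sub_X_pow k i) d
    · exact key r _ (isHomogeneous_esymm n r) (exists_mem_vanishingIdeal_sub_esymm h) d
  | zero => exact ⟨0, zero_mem _, by simp⟩
  | add p q _ _ hp hq =>
    obtain ⟨g, hg, h⟩ := hp d
    obtain ⟨g', hg', h'⟩ := hq d
    refine ⟨g + g', add_mem hg hg', ?_⟩
    rw [map_add, add_sub_add_comm]
    exact add_mem h h'
  | smul a p _ hp =>
    rw [smul_eq_mul]
    induction a using MvPolynomial.induction_on generalizing d with
    | C c =>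
      obtain ⟨g, hg, h⟩ := hp d
      refine ⟨C c * g, Ideal.mul_mem_left _ _ hg, ?_⟩
      rw [homogeneousComponent_C_mul, ← mul_sub]
      exact C_mul_mem_degreeLT _ h
    | add a b ha hb =>
      obtain ⟨g, hg, h⟩ := ha d
      obtain ⟨g', hg', h'⟩ := hb d
      refine ⟨g + g', add_mem hg hg', ?_⟩
      rw [add_mul, map_add, add_sub_add_comm]
      exact add_mem h h'
    | mul_X a i ha =>
      rw [mul_right_comm, mul_comm]
      cases d with
      | zero => exact ⟨0, zero_mem _, by simp [coeff_X_mul']⟩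
      | succ d =>
        obtain ⟨g, hg, h⟩ := ha d
        refine ⟨X i * g, Ideal.mul_mem_left _ _ hg, ?_⟩
        rw [homogeneousComponent_succ_X_mul, ← mul_sub]
        exact X_mul_mem_degreeLT _ h

end GenCoinv

/-! ### Ordered set partitions as points, and interpolation. -/

namespace GenCoinv
open MvPolynomial

namespace OrderedSetPartition

variable {n k : ℕ}

/-- The position of the block containing a given element. -/
noncomputable def index (σ : OrderedSetPartition n k) (a : Fin n) : Fin k := (σ.cover a).choose

theorem mem_block_iff (σ : OrderedSetPartition n k) (a : Fin n) (i : Fin k) :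
    a ∈ σ.block i ↔ σ.index a = i := by
  have h : a ∈ σ.block (σ.index a) := (σ.cover a).choose_spec
  refine ⟨fun hi => ?_, fun hi => hi ▸ h⟩
  by_contra hne
  exact Finset.disjoint_left.1 (σ.disjoint _ _ hne) h hi

theorem index_surjective (σ : OrderedSetPartition n k) : Function.Surjective σ.index := fun i => by
  obtain ⟨a, ha⟩ := σ.nonempty i
  exact ⟨a, (σ.mem_block_iff a i).1 ha⟩

theorem index_injective :
    Function.Injective (index : OrderedSetPartition n k → Fin n → Fin k) := fun σ τ h => by
  ext i a
  rw [mem_block_iff, mem_block_iff, h]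

theorem index_smul (w : Equiv.Perm (Fin n)) (σ : OrderedSetPartition n k) (a : Fin n) :
    (w • σ).index a = σ.index (w⁻¹ a) := by
  rw [← mem_block_iff, smul_block, Finset.mem_map_equiv, mem_block_iff]
  rfl

/-- Ordered set partitions are the same as surjections. -/
noncomputable def equivSurjective :
    OrderedSetPartition n k ≃ {f : Fin n → Fin k // Function.Surjective f} :=
  Equiv.ofBijective (fun σ => ⟨σ.index, σ.index_surjective⟩) <| by
    classical
    refine ⟨fun σ τ h => index_injective (congrArg Subtype.val h), fun f => ?_⟩
    refine ⟨⟨fun i => Finset.univ.filter fun a => f.1 a = i, fun i => ?_, fun i j h => ?_,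
      fun a => ⟨f.1 a, by simp⟩⟩, ?_⟩
    · obtain ⟨a, ha⟩ := f.2 i
      exact ⟨a, by simpa using ha⟩
    · rw [Finset.disjoint_left]
      intro a hi hj
      exact h ((Finset.mem_filter.1 hi).2.symm.trans (Finset.mem_filter.1 hj).2)
    · ext a : 2
      dsimp only
      rw [← mem_block_iff]
      simp

theorem index_equivSurjective_symm (f : {f : Fin n → Fin k // Function.Surjective f}) :
    (equivSurjective.symm f).index = f.1 :=
  congrArg Subtype.val (equivSurjective.apply_symm_apply f)

instance : Finite (OrderedSetPartition n k) := Finite.of_equiv _ equivSurjective.symm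

end OrderedSetPartition

/-- Evaluation of polynomials at the points attached to ordered set partitions. -/
noncomputable def evalPoints (n k : ℕ) :
    MvPolynomial (Fin n) ℚ →ₗ[ℚ] MonoidAlgebra ℚ (OrderedSetPartition n k) where
  toFun f := .ofCoeff (Finsupp.equivFunOnFinite.symm fun σ => eval (point σ.index) f)
  map_add' f g := by
    ext σ
    simp
  map_smul' c f := by
    ext σ
    simp [smul_eval]

theorem coeff_evalPoints {n k : ℕ} (f : MvPolynomial (Fin n) ℚ) (σ : OrderedSetPartition n k) :
    (evalPoints n k f).coeff σ = eval (point σ.index) f := rfl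

theorem evalPoints_eq_zero {n k : ℕ} {f : MvPolynomial (Fin n) ℚ} (hf : f ∈ vanishingIdeal n k) :
    evalPoints n k f = 0 := by
  ext σ
  exact hf _ σ.index_surjective

theorem evalPoints_rename {n k : ℕ} (w : Equiv.Perm (Fin n)) (f : MvPolynomial (Fin n) ℚ) :
    evalPoints n k (rename w f) =
      Representation.ofMulAction ℚ _ (OrderedSetPartition n k) w (evalPoints n k f) := by
  ext σ
  rw [Representation.coeff_ofMulAction, coeff_evalPoints, coeff_evalPoints, eval_rename]
  congr 2
  ext a
  simp [point, OrderedSetPartition.index_smul]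

theorem evalPoints_surjective (n k : ℕ) : Function.Surjective (evalPoints n k) := by
  classical
  rw [← LinearMap.range_eq_top, eq_top_iff]
  rintro x -
  induction x using MonoidAlgebra.induction_linear with
  | zero => exact zero_mem _
  | add x y hx hy => exact add_mem hx hy
  | single σ r =>
    -- Lagrange interpolation: `L` is nonzero at the point of `σ` and zero at all the others.
    set L : MvPolynomial (Fin n) ℚ :=
      ∏ a, ∏ j ∈ Finset.univ.erase (σ.index a), (X a - C ((j : ℕ) : ℚ)) with hL
    have h0 : eval (point σ.index) L ≠ 0 := by
      simp only [hL, map_prod, Finset.prod_ne_zero_iff]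
      intro a _ j hj
      simp only [map_sub, eval_X, eval_C, point, sub_ne_zero]
      rw [Ne, Nat.cast_inj, Fin.val_inj]
      exact (Finset.ne_of_mem_erase hj).symm
    have h1 : ∀ τ : OrderedSetPartition n k, τ ≠ σ → eval (point τ.index) L = 0 := by
      intro τ hτ
      obtain ⟨a, ha⟩ : ∃ a, τ.index a ≠ σ.index a := by
        by_contra! h
        exact hτ (OrderedSetPartition.index_injective (funext h))
      simp only [hL, map_prod]
      refine Finset.prod_eq_zero (Finset.mem_univ a) (Finset.prod_eq_zero
        (Finset.mem_erase.2 ⟨ha, Finset.mem_univ _⟩) ?_)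
      simp [point]
    refine ⟨(r / eval (point σ.index) L) • L, ?_⟩
    ext τ
    rw [coeff_evalPoints, smul_eval, MonoidAlgebra.coeff_single, Finsupp.single_apply]
    split_ifs with h
    · subst h
      field_simp
    · rw [h1 τ (Ne.symm h), mul_zero]

/-! ### Equivariant projection onto the ideal and the module isomorphism. -/

/-- There is a linear projection onto the ideal `I_{n,k}` which does not raise degrees. -/
theorem exists_projection (n k : ℕ) : ∃ p : MvPolynomial (Fin n) ℚ →ₗ[ℚ] MvPolynomial (Fin n) ℚ,
    (∀ f, p f ∈ idealI n k) ∧ (∀ f ∈ idealI n k, p f = f) ∧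
      ∀ d, ∀ f ∈ degreeLT n d, p f ∈ degreeLT n d := by
  let I : ℕ → Submodule ℚ (MvPolynomial (Fin n) ℚ) := fun d =>
    (idealI n k).restrictScalars ℚ ⊓ homogeneousSubmodule (Fin n) ℚ d
  -- In each degree, a linear retraction onto the degree `d` part of the ideal; `p` applies the one
  -- of matching degree to each monomial.
  choose q hq using fun d => (I d).subtype.exists_leftInverse_of_injective (I d).ker_subtype
  let p : MvPolynomial (Fin n) ℚ →ₗ[ℚ] MvPolynomial (Fin n) ℚ :=
    (basisMonomials (Fin n) ℚ).constr ℚ fun m => (q m.degree (monomial m 1) : MvPolynomial _ ℚ)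
  have hp : ∀ m, p (monomial m 1) = q m.degree (monomial m 1) := fun m => by
    have h := (basisMonomials (Fin n) ℚ).constr_basis ℚ
      (fun m => (q m.degree (monomial m 1) : MvPolynomial (Fin n) ℚ)) m
    rwa [coe_basisMonomials] at h
  have hf : ∀ f : MvPolynomial (Fin n) ℚ,
      f = ∑ m ∈ f.support, coeff m f • monomial m (1 : ℚ) := fun f => by
    conv_lhs => rw [← support_sum_monomial_coeff f]
    exact Finset.sum_congr rfl fun m _ => by rw [smul_monomial, smul_eq_mul, mul_one]
  have hpf : ∀ f, p f = ∑ m ∈ f.support,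
      coeff m f • (q m.degree (monomial m 1) : MvPolynomial (Fin n) ℚ) := fun f => by
    conv_lhs => rw [hf f, map_sum]
    exact Finset.sum_congr rfl fun m _ => by rw [map_smul, hp]
  refine ⟨p, fun f => ?_, fun f hfI => ?_, fun d f hd => ?_⟩
  · rw [hpf]
    exact ((idealI n k).restrictScalars ℚ).sum_mem fun m _ =>
      Submodule.smul_mem _ _ (q m.degree (monomial m 1)).2.1
  · have hom : ∀ d, ∀ f ∈ I d, p f = f := by
      intro d f hfd
      have h1 : (q d f : MvPolynomial (Fin n) ℚ) = f :=
        congrArg Subtype.val (LinearMap.congr_fun (hq d) ⟨f, hfd⟩)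
      conv_rhs => rw [← h1, hf f, map_sum]
      rw [hpf, Submodule.coe_sum]
      refine Finset.sum_congr rfl fun m hm => ?_
      have hm' : m.degree = d := by
        by_contra h
        exact mem_support_iff.1 hm (IsHomogeneous.coeff_eq_zero hfd.2 h)
      rw [map_smul, hm']
      rfl
    conv_rhs => rw [← sum_homogeneousComponent f]
    conv_lhs => rw [← sum_homogeneousComponent f]
    rw [map_sum]
    exact Finset.sum_congr rfl fun d _ => hom d _
      ⟨homogeneousComponent_mem_idealI hfI d, homogeneousComponent_mem d f⟩
  · rw [hpf]
    exact Submodule.sum_mem _ fun m hm => Submodule.smul_mem _ _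
      (IsHomogeneous.mem_degreeLT (q m.degree (monomial m 1)).2.2 (hd m (mem_support_iff.1 hm)))

theorem rename_mem_idealI {n k : ℕ} (w : Equiv.Perm (Fin n)) {f : MvPolynomial (Fin n) ℚ}
    (hf : f ∈ idealI n k) : rename w f ∈ idealI n k :=
  idealI_le_comap n k w hf

/-- There is an equivariant linear projection onto `I_{n,k}` which does not raise degrees. -/
theorem exists_equivariant_projection (n k : ℕ) :
    ∃ p : MvPolynomial (Fin n) ℚ →ₗ[ℚ] MvPolynomial (Fin n) ℚ,
      (∀ f, p f ∈ idealI n k) ∧ (∀ f ∈ idealI n k, p f = f) ∧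
        (∀ d, ∀ f ∈ degreeLT n d, p f ∈ degreeLT n d) ∧
          ∀ (w : Equiv.Perm (Fin n)) (f), p (rename w f) = rename w (p f) := by
  obtain ⟨p, h1, h2, h3⟩ := exists_projection n k
  let r : Equiv.Perm (Fin n) → MvPolynomial (Fin n) ℚ →ₗ[ℚ] MvPolynomial (Fin n) ℚ :=
    fun w => (rename w : MvPolynomial (Fin n) ℚ →ₐ[ℚ] MvPolynomial (Fin n) ℚ).toLinearMap
  let c : ℚ := (Fintype.card (Equiv.Perm (Fin n)) : ℚ)⁻¹
  -- Averaging the conjugates of `p`; permuting variables preserves both the ideal and the degree.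
  let P : MvPolynomial (Fin n) ℚ →ₗ[ℚ] MvPolynomial (Fin n) ℚ :=
    c • ∑ w : Equiv.Perm (Fin n), r w ∘ₗ p ∘ₗ r w⁻¹
  have hP : ∀ f, P f = c • ∑ w : Equiv.Perm (Fin n), rename w (p (rename (w⁻¹ : Equiv.Perm _) f)) :=
    fun f => by simp [P, r]
  refine ⟨P, fun f => ?_, fun f hf => ?_, fun d f hd => ?_, fun v f => ?_⟩
  · rw [hP]
    exact ((idealI n k).restrictScalars ℚ).smul_mem _
      (Submodule.sum_mem _ fun w _ => rename_mem_idealI w (h1 _))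
  · have h : ∀ w : Equiv.Perm (Fin n), rename w (p (rename (w⁻¹ : Equiv.Perm _) f)) = f := by
      intro w
      rw [h2 _ (rename_mem_idealI w⁻¹ hf), rename_rename]
      convert rename_id_apply f
      ext a
      simp
    rw [hP, Finset.sum_congr rfl fun w _ => h w, Finset.sum_const, Finset.card_univ,
      ← Nat.cast_smul_eq_nsmul ℚ, smul_smul, inv_mul_cancel₀, one_smul]
    exact Nat.cast_ne_zero.2 Fintype.card_ne_zero
  · rw [hP]
    exact Submodule.smul_mem _ _ (Submodule.sum_mem _ fun w _ =>
      rename_mem_degreeLT w (h3 d _ (rename_mem_degreeLT w⁻¹ hd)))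
  · rw [hP, hP, map_smul, map_sum]
    congr 1
    rw [← Equiv.sum_comp (Equiv.mulLeft v)]
    refine Finset.sum_congr rfl fun w _ => ?_
    have h : rename ((v * w)⁻¹ : Equiv.Perm _) (rename v f) = rename (w⁻¹ : Equiv.Perm _) f := by
      rw [rename_rename, ← Equiv.Perm.coe_mul, mul_inv_rev, inv_mul_cancel_right]
    rw [Equiv.coe_mulLeft, h, rename_rename, Equiv.Perm.coe_mul]

/-- Evaluation itself need not kill `I_{n,k}`; subtracting `p` first corrects this, and the
correction only costs terms of lower degree. -/
theorem exists_equivariant_surjection (n k : ℕ) :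
    ∃ Φ : MvPolynomial (Fin n) ℚ →ₗ[ℚ] MonoidAlgebra ℚ (OrderedSetPartition n k),
      (∀ f ∈ idealI n k, Φ f = 0) ∧ Function.Surjective Φ ∧
        ∀ (w : Equiv.Perm (Fin n)) (f), Φ (rename w f) =
          Representation.ofMulAction ℚ _ (OrderedSetPartition n k) w (Φ f) := by
  obtain ⟨p, h1, h2, h3, h4⟩ := exists_equivariant_projection n k
  let Φ := evalPoints n k ∘ₗ (LinearMap.id - p)
  have hΦ : ∀ f, Φ f = evalPoints n k (f - p f) := fun f => rfl
  refine ⟨Φ, fun f hf => ?_, ?_, fun w f => ?_⟩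
  · rw [hΦ, h2 f hf, sub_self, map_zero]
  · have key : ∀ d, ∀ f ∈ degreeLT n d, evalPoints n k f ∈ LinearMap.range Φ := by
      intro d
      induction d with
      | zero =>
        intro f hf
        rw [degreeLT_zero hf, map_zero]
        exact zero_mem _
      | succ d ih =>
        intro f hf
        -- `g` vanishes at all points and shares the degree `d` part of `p f`, so `p f` may be
        -- replaced by `p f - g`, of degree below `d`.
        obtain ⟨g, hg, hgd⟩ := exists_mem_vanishingIdeal_sub_homogeneousComponent (h1 f) d
        have h5 : p f - g ∈ degreeLT n d := by
          have h6 := sub_mem (sub_homogeneousComponent_mem_degreeLT (h3 _ f hf)) hgd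
          convert h6 using 1
          ring
        have h7 : evalPoints n k f = Φ f + evalPoints n k (p f - g) := by
          rw [hΦ, map_sub, map_sub, evalPoints_eq_zero hg]
          abel
        rw [h7]
        exact add_mem ⟨f, rfl⟩ (ih _ h5)
    intro x
    obtain ⟨f, rfl⟩ := evalPoints_surjective n k x
    exact key _ f (mem_degreeLT_totalDegree_succ f)
  · rw [hΦ, hΦ, h4, ← map_sub, evalPoints_rename]

theorem nonempty_equiv_ofMulAction (n k : ℕ) :
    Nonempty (Representation.Equiv (repR n k)
      (Representation.ofMulAction ℚ (Equiv.Perm (Fin n)) (OrderedSetPartition n k))) := by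
  obtain ⟨Φ, h1, h2, h3⟩ := exists_equivariant_surjection n k
  obtain ⟨hfin, hrank⟩ := finite_and_finrank_ringR_le n k
  let Ψ : RingR n k →ₗ[ℚ] MonoidAlgebra ℚ (OrderedSetPartition n k) :=
    (((idealI n k).restrictScalars ℚ).liftQ Φ fun f hf => h1 f hf) ∘ₗ
      (Submodule.Quotient.restrictScalarsEquiv ℚ (idealI n k)).symm.toLinearMap
  have hΨ : ∀ f, Ψ (Ideal.Quotient.mk _ f) = Φ f := fun f => rfl
  have hsurj : Function.Surjective Ψ := fun x => by
    obtain ⟨f, rfl⟩ := h2 x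
    exact ⟨Ideal.Quotient.mk _ f, hΨ f⟩
  have hdim : Module.finrank ℚ (RingR n k) =
      Module.finrank ℚ (MonoidAlgebra ℚ (OrderedSetPartition n k)) := by
    refine le_antisymm (hrank.trans (le_of_eq ?_)) (LinearMap.finrank_le_finrank_of_surjective hsurj)
    have := Fintype.ofFinite (OrderedSetPartition n k)
    rw [(MonoidAlgebra.coeffLinearEquiv ℚ).finrank_eq, Module.finrank_finsupp_self,
      ← Nat.card_eq_fintype_card, Nat.card_congr OrderedSetPartition.equivSurjective]
  have : Module.Finite ℚ (MonoidAlgebra ℚ (OrderedSetPartition n k)) :=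
    Module.Finite.equiv (MonoidAlgebra.coeffLinearEquiv ℚ).symm
  have hinj := (LinearMap.injective_iff_surjective_of_finrank_eq_finrank hdim).2 hsurj
  refine ⟨Representation.Equiv.mk (LinearEquiv.ofBijective Ψ ⟨hinj, hsurj⟩) fun w => ?_⟩
  refine LinearMap.ext fun x => ?_
  obtain ⟨f, rfl⟩ := Ideal.Quotient.mk_surjective x
  rw [LinearMap.comp_apply, LinearMap.comp_apply, repR_mk]
  exact h3 w f

end GenCoinv

/-! ### Power sums as counts of fixed words. -/

namespace GenCoinv

/-- The exponent vector of the monomial `∏ x_{g j}`. -/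
noncomputable def content {J : Type*} [Fintype J] (g : J → ℕ) : ℕ →₀ ℕ :=
  ∑ j, Finsupp.single (g j) 1

theorem degree_content {J : Type*} [Fintype J] (g : J → ℕ) :
    (content g).degree = Fintype.card J := by
  simp [content, map_sum, Finsupp.degree_single]

theorem content_comp_perm {J : Type*} [Fintype J] (g : J → ℕ) (w : Equiv.Perm J) :
    content (g ∘ w) = content g :=
  Equiv.sum_comp w fun j => Finsupp.single (g j) 1

theorem content_apply {J : Type*} [Fintype J] [DecidableEq J] (g : J → ℕ) (m : ℕ) :
    content g m = (Finset.univ.filter fun j => g j = m).card := by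
  simp [content, Finsupp.finsetSum_apply, Finsupp.single_apply]

theorem mem_support_content {J : Type*} [Fintype J] (g : J → ℕ) (j : J) :
    g j ∈ (content g).support := by
  classical
  rw [Finsupp.mem_support_iff, content_apply, ← Nat.pos_iff_ne_zero, Finset.card_pos]
  exact ⟨j, by simp⟩

theorem coeff_powerSum (d : ℕ) (m : ℕ →₀ ℕ) [Decidable (∃ i, m = Finsupp.single i d)] :
    MvPowerSeries.coeff m (powerSum d) = if ∃ i : ℕ, m = Finsupp.single i d then 1 else 0 := by
  change (powerSum d) m = _
  rw [powerSum]
  congr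

/-- The functions `J → ℕ` that are constant on the fibres of `π`, counted by content. -/
theorem coeff_prod_powerSum {J S : Type*} [Fintype J] [Fintype S] [DecidableEq S] (π : J → S)
    (hπ : Function.Surjective π) (a : ℕ →₀ ℕ) :
    MvPowerSeries.coeff a
        (∏ s, powerSum (Finset.univ.filter fun j => π j = s).card) =
      (Nat.card {g : J → ℕ // (∀ i j, π i = π j → g i = g j) ∧ content g = a} : ℚ) := by
  classical
  set c : S → ℕ := fun s => (Finset.univ.filter fun j => π j = s).card with hc
  have hc0 : ∀ s, c s ≠ 0 := fun s => by
    obtain ⟨j, hj⟩ := hπ s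
    exact (Finset.card_pos.2 ⟨j, by simpa using hj⟩).ne'
  have h1 : ∀ G : S → ℕ, content (G ∘ π) = ∑ s, Finsupp.single (G s) (c s) := fun G => by
    refine (Finset.sum_fiberwise' Finset.univ π fun s => Finsupp.single (G s) 1).symm.trans
      (Finset.sum_congr rfl fun s _ => ?_)
    rw [Finset.sum_const, Finsupp.smul_single, smul_eq_mul, mul_one]
  have e1 : Nat.card {G : S → ℕ // ∑ s, Finsupp.single (G s) (c s) = a} =
      Nat.card {g : J → ℕ // (∀ i j, π i = π j → g i = g j) ∧ content g = a} := by
    refine Nat.card_congr (Equiv.ofBijective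
      (fun G => ⟨G.1 ∘ π, fun i j h => congrArg G.1 h, (h1 G.1).trans G.2⟩) ⟨?_, ?_⟩)
    · intro G G' h
      exact Subtype.ext (hπ.injective_comp_right (congrArg Subtype.val h))
    · rintro ⟨g, hg, hga⟩
      have h2 : (g ∘ Function.surjInv hπ) ∘ π = g := funext fun j =>
        hg _ _ (Function.surjInv_eq hπ (π j))
      refine ⟨⟨g ∘ Function.surjInv hπ, ?_⟩, Subtype.ext h2⟩
      rw [← h1, h2, hga]
  -- Choosing a monomial `x_{G s}^{c s}` from each factor; `G s` is determined by it because `c s ≠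
  -- 0`.
  have e2 : Nat.card {G : S → ℕ // ∑ s, Finsupp.single (G s) (c s) = a} =
      ((Finset.finsuppAntidiag Finset.univ a).filter
        fun l : S →₀ (ℕ →₀ ℕ) => ∀ s, ∃ i, l s = Finsupp.single i (c s)).card := by
    rw [← Nat.card_eq_finsetCard]
    refine Nat.card_congr (Equiv.ofBijective (fun G =>
      ⟨Finsupp.equivFunOnFinite.symm fun s => Finsupp.single (G.1 s) (c s), ?_⟩) ⟨?_, ?_⟩)
    · simp only [Finset.mem_filter, Finset.mem_finsuppAntidiag, Finset.subset_univ, and_true]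
      exact ⟨G.2, fun s => ⟨G.1 s, rfl⟩⟩
    · intro G G' h
      refine Subtype.ext (funext fun s => ?_)
      have h2 := DFunLike.congr_fun (congrArg Subtype.val h) s
      exact Finsupp.single_left_injective (hc0 s) h2
    · rintro ⟨l, hl⟩
      simp only [Finset.mem_filter, Finset.mem_finsuppAntidiag, Finset.subset_univ, and_true] at hl
      choose G hG using hl.2
      refine ⟨⟨G, ?_⟩, Subtype.ext (Finsupp.ext fun s => (hG s).symm)⟩
      rw [← hl.1]
      exact Finset.sum_congr rfl fun s _ => (hG s).symm
  rw [MvPowerSeries.coeff_prod, ← e1, e2, Finset.card_filter, Nat.cast_sum]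
  refine Finset.sum_congr rfl fun l _ => ?_
  simp only [coeff_powerSum]
  rw [Finset.prod_ite_zero]
  simp [hc]

section Cycles

variable {n : ℕ} (w : Equiv.Perm (Fin n))

/-- The map sending a point to its cycle, with the fixed points as additional cycles. -/
def toCycle (x : Fin n) : {c // c ∈ w.cycleFactorsFinset} ⊕ {x // w x = x} :=
  if h : w x = x then Sum.inr ⟨x, h⟩ else
    Sum.inl ⟨w.cycleOf x, Equiv.Perm.cycleOf_mem_cycleFactorsFinset_iff.2
      (Equiv.Perm.mem_support.2 h)⟩

theorem toCycle_eq_inr_iff (x : Fin n) (y : {x // w x = x}) :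
    toCycle w x = Sum.inr y ↔ x = y.1 := by
  rw [toCycle]
  split_ifs with h
  · rw [Sum.inr.injEq, Subtype.ext_iff]
  · simp only [false_iff]
    rintro rfl
    exact h y.2

theorem toCycle_eq_inl_iff (x : Fin n) (c : {c // c ∈ w.cycleFactorsFinset}) :
    toCycle w x = Sum.inl c ↔ x ∈ c.1.support := by
  rw [← Equiv.Perm.eq_cycleOf_of_mem_cycleFactorsFinset_iff w c.1 c.2, toCycle]
  split_ifs with h
  · simp only [false_iff]
    intro hc
    have h1 := (Equiv.Perm.mem_cycleFactorsFinset_iff.1 c.2).1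
    rw [hc] at h1
    exact (Equiv.Perm.isCycle_cycleOf_iff w).1 h1 h
  · rw [Sum.inl.injEq, Subtype.ext_iff, eq_comm]

theorem toCycle_surjective : Function.Surjective (toCycle w) := by
  rintro (c | y)
  · obtain ⟨x, hx⟩ := (Equiv.Perm.mem_cycleFactorsFinset_iff.1 c.2).1.nonempty_support
    exact ⟨x, (toCycle_eq_inl_iff w x c).2 hx⟩
  · exact ⟨y.1, (toCycle_eq_inr_iff w _ y).2 rfl⟩

theorem sameCycle_of_toCycle_eq {x y : Fin n} (h : toCycle w x = toCycle w y) :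
    w.SameCycle x y := by
  by_cases hy : w y = y
  · have h1 := (toCycle_eq_inr_iff w y ⟨y, hy⟩).2 rfl
    rw [h1, toCycle_eq_inr_iff] at h
    rw [h]
  · have h1 : toCycle w y = Sum.inl _ := dif_neg hy
    rw [h1, toCycle_eq_inl_iff] at h
    exact ((Equiv.Perm.mem_support_cycleOf_iff.1 h).1).symm

theorem toCycle_apply (x : Fin n) : toCycle w (w x) = toCycle w x := by
  by_cases hx : w x = x
  · rw [hx]
  · have h1 : toCycle w x = Sum.inl _ := dif_neg hx
    rw [h1, toCycle_eq_inl_iff, Equiv.Perm.mem_support_cycleOf_iff' hx]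
    exact Equiv.Perm.sameCycle_apply_right.2 (Equiv.Perm.SameCycle.refl _ _)

theorem forall_toCycle_eq_iff (g : Fin n → ℕ) :
    (∀ i j, toCycle w i = toCycle w j → g i = g j) ↔ g ∘ w = g := by
  refine ⟨fun h => funext fun j => h _ _ (toCycle_apply w j), fun h i j hij => ?_⟩
  obtain ⟨z, rfl⟩ := sameCycle_of_toCycle_eq w hij
  have h1 : ∀ (m : ℕ) (x : Fin n), g ((w ^ m) x) = g x := by
    intro m
    induction m with
    | zero => simp
    | succ m ih =>
      intro x
      rw [pow_succ, Equiv.Perm.mul_apply, ih]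
      exact congrFun h x
  obtain ⟨m, rfl | rfl⟩ := z.eq_nat_or_neg
  · rw [zpow_natCast, h1]
  · rw [zpow_neg, zpow_natCast]
    have h2 := h1 m ((w ^ m)⁻¹ i)
    rwa [← Equiv.Perm.mul_apply, mul_inv_cancel] at h2

theorem powerSumCycle_eq_prod : powerSumCycle w =
    ∏ s, powerSum (Finset.univ.filter fun j => toCycle w j = s).card := by
  rw [powerSumCycle, Equiv.Perm.parts_partition, Multiset.map_add, Multiset.prod_add,
    Fintype.prod_sum_type, Equiv.Perm.cycleType_def, Multiset.map_map]
  congr 1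
  · refine (Finset.prod_coe_sort w.cycleFactorsFinset fun c => powerSum c.support.card).symm.trans
      (Finset.prod_congr rfl fun c _ => ?_)
    congr 2
    ext x
    simp [toCycle_eq_inl_iff]
  · have h : ∀ y : {x // w x = x},
        (Finset.univ.filter fun j => toCycle w j = Sum.inr y).card = 1 := fun y => by
      rw [Finset.card_eq_one]
      exact ⟨y.1, by ext x; simp [toCycle_eq_inr_iff]⟩
    simp only [h, Multiset.map_replicate, Multiset.prod_replicate, Finset.prod_const,
      Finset.card_univ]
    congr 1
    rw [Fintype.card_subtype, ← Finset.card_compl]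
    congr 1
    ext x
    simp

/-- A word is fixed by `w` exactly when it is constant on cycles. Power sums thereby become
fixed-point counts, as Burnside requires. -/
theorem coeff_powerSumCycle (a : ℕ →₀ ℕ) :
    MvPowerSeries.coeff a (powerSumCycle w) =
      (Nat.card {g : Fin n → ℕ // g ∘ w = g ∧ content g = a} : ℚ) := by
  rw [powerSumCycle_eq_prod, coeff_prod_powerSum _ (toCycle_surjective w)]
  simp only [forall_toCycle_eq_iff]

end Cycles

theorem character_ofMulAction {G H : Type*} [Group G] [MulAction G H] [Finite H] (g : G) :
    (Representation.ofMulAction ℚ G H).character g = (Nat.card (MulAction.fixedBy H g) : ℚ) := by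
  classical
  have := Fintype.ofFinite H
  let b : Module.Basis H ℚ (MonoidAlgebra ℚ H) := .ofRepr (MonoidAlgebra.coeffLinearEquiv ℚ)
  have hb : ∀ h, b h = MonoidAlgebra.single h 1 := fun h => rfl
  have hr : ∀ x h, b.repr x h = x.coeff h := fun x h => rfl
  rw [Representation.character, LinearMap.trace_eq_matrix_trace ℚ b, Matrix.trace]
  simp only [Matrix.diag_apply, LinearMap.toMatrix_apply, hb, hr,
    Representation.ofMulAction_single, MonoidAlgebra.coeff_single, Finsupp.single_apply]
  rw [Finset.sum_boole, ← Fintype.card_subtype, Nat.card_eq_fintype_card]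
  rfl

end GenCoinv

/-! ### Burnside count of pairs of an ordered set partition and a word. -/

namespace GenCoinv

/-- The functions `[n] → ℕ` with content `a`. -/
@[ext]
structure ContentFun (n : ℕ) (a : ℕ →₀ ℕ) where
  val : Fin n → ℕ
  content_eq : content val = a

instance (n : ℕ) (a : ℕ →₀ ℕ) : MulAction (Equiv.Perm (Fin n)) (ContentFun n a) where
  smul w g := ⟨g.1 ∘ (w⁻¹ : Equiv.Perm (Fin n)), (content_comp_perm _ _).trans g.2⟩
  one_smul _ := rfl
  mul_smul v w g := ContentFun.ext (funext fun i => by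
    change g.1 ((v * w)⁻¹ i) = g.1 (w⁻¹ (v⁻¹ i))
    rw [mul_inv_rev, Equiv.Perm.mul_apply])

theorem ContentFun.smul_val {n : ℕ} {a : ℕ →₀ ℕ} (w : Equiv.Perm (Fin n)) (g : ContentFun n a) :
    (w • g).1 = g.1 ∘ (w⁻¹ : Equiv.Perm (Fin n)) := rfl

instance (n : ℕ) (a : ℕ →₀ ℕ) : Finite (ContentFun n a) := by
  refine Finite.of_injective (β := Fin n → a.support)
    (fun g j => ⟨g.1 j, by have h := mem_support_content g.1 j; rwa [g.2] at h⟩) fun g g' h => ?_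
  exact ContentFun.ext (funext fun j => congrArg Subtype.val (congrFun h j))

theorem card_fixedBy_contentFun {n : ℕ} (a : ℕ →₀ ℕ) (w : Equiv.Perm (Fin n)) :
    Nat.card (MulAction.fixedBy (ContentFun n a) w) =
      Nat.card {g : Fin n → ℕ // g ∘ w = g ∧ content g = a} := by
  have key : ∀ g : ContentFun n a, w • g = g ↔ g.1 ∘ w = g.1 := fun g => by
    rw [ContentFun.ext_iff, ContentFun.smul_val]
    constructor
    · intro h
      conv_lhs => rw [← h]
      ext j
      simp
    · intro h
      conv_lhs => rw [← h]
      ext j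
      simp
  exact Nat.card_congr
    { toFun := fun g => ⟨g.1.1, (key g.1).1 g.2, g.1.2⟩
      invFun := fun g => ⟨⟨g.1, g.2.2⟩, (key _).2 g.2.1⟩
      left_inv := fun _ => rfl
      right_inv := fun _ => rfl }

theorem sum_card_fixedBy_mul_card_fixedBy (G X Y : Type*) [Group G] [Fintype G] [MulAction G X]
    [MulAction G Y] [Finite X] [Finite Y] :
    ∑ g : G, Nat.card (MulAction.fixedBy X g) * Nat.card (MulAction.fixedBy Y g) =
      Nat.card (MulAction.orbitRel.Quotient G (X × Y)) * Fintype.card G := by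
  classical
  have := Fintype.ofFinite (X × Y)
  have := Fintype.ofFinite (MulAction.orbitRel.Quotient G (X × Y))
  rw [Nat.card_eq_fintype_card]
  refine Eq.trans ?_ (MulAction.sum_card_fixedBy_eq_card_orbits_mul_card_group G (X × Y))
  refine Finset.sum_congr rfl fun g _ => ?_
  rw [← Nat.card_prod, ← Nat.card_eq_fintype_card]
  exact Nat.card_congr
    { toFun := fun p => ⟨(p.1.1, p.2.1), Prod.ext p.1.2 p.2.2⟩
      invFun := fun p => (⟨p.1.1, congrArg Prod.fst p.2⟩, ⟨p.1.2, congrArg Prod.snd p.2⟩)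
      left_inv := fun _ => rfl
      right_inv := fun _ => rfl }

/-- The sequences of `k` nonzero exponent vectors with sum `a`. -/
abbrev ExponentSeq (k : ℕ) (a : ℕ →₀ ℕ) : Type :=
  {l : Fin k → ℕ →₀ ℕ // ∑ i, l i = a ∧ ∀ i, l i ≠ 0}

section Profile

variable {n k : ℕ}

/-- The exponent vectors of the monomials attached to the blocks. -/
noncomputable def profile (f : Fin n → Fin k) (g : Fin n → ℕ) (i : Fin k) : ℕ →₀ ℕ :=
  ∑ j with f j = i, Finsupp.single (g j) 1

theorem profile_apply (f : Fin n → Fin k) (g : Fin n → ℕ) (i : Fin k) (m : ℕ) :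
    profile f g i m = (Finset.univ.filter fun j => (f j, g j) = (i, m)).card := by
  simp [profile, Finsupp.finsetSum_apply, Finsupp.single_apply, Finset.filter_filter]

theorem sum_profile (f : Fin n → Fin k) (g : Fin n → ℕ) : ∑ i, profile f g i = content g :=
  Finset.sum_fiberwise _ _ _

theorem profile_ne_zero {f : Fin n → Fin k} (hf : Function.Surjective f) (g : Fin n → ℕ)
    (i : Fin k) : profile f g i ≠ 0 := fun h => by
  obtain ⟨j, hj⟩ := hf i
  have h1 := DFunLike.congr_fun h (g j)
  rw [profile_apply, Finsupp.zero_apply, Finset.card_eq_zero] at h1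
  have h2 : j ∈ Finset.univ.filter fun j' => (f j', g j') = (i, g j) := by simp [hj]
  rw [h1] at h2
  simp at h2

theorem profile_comp_perm (f : Fin n → Fin k) (g : Fin n → ℕ) (w : Equiv.Perm (Fin n)) :
    profile (f ∘ w) (g ∘ w) = profile f g := by
  funext i
  rw [profile, profile, Finset.sum_filter, Finset.sum_filter]
  exact Equiv.sum_comp w fun j => if f j = i then Finsupp.single (g j) 1 else 0

/-- Fibres of equal size are in bijection, and these bijections glue to a permutation. -/
theorem exists_perm_comp_eq {J T : Type*} [Fintype J] [DecidableEq T] (F F' : J → T)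
    (h : ∀ t, (Finset.univ.filter fun j => F j = t).card =
      (Finset.univ.filter fun j => F' j = t).card) :
    ∃ w : Equiv.Perm J, F' ∘ w = F := by
  have e : ∀ t, Nonempty ({j // F j = t} ≃ {j // F' j = t}) := fun t => by
    refine ⟨Fintype.equivOfCardEq ?_⟩
    rw [Fintype.card_subtype, Fintype.card_subtype, h]
  refine ⟨(Equiv.sigmaFiberEquiv F).symm.trans
    ((Equiv.sigmaCongrRight fun t => (e t).some).trans (Equiv.sigmaFiberEquiv F')),
    funext fun j => ?_⟩
  exact ((e (F j)).some ⟨j, rfl⟩).2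

theorem exists_perm_of_profile_eq {f f' : Fin n → Fin k} {g g' : Fin n → ℕ}
    (h : profile f g = profile f' g') : ∃ w : Equiv.Perm (Fin n), f' ∘ w = f ∧ g' ∘ w = g := by
  obtain ⟨w, hw⟩ := exists_perm_comp_eq (fun j => (f j, g j)) (fun j => (f' j, g' j)) fun t => by
    rw [← profile_apply, ← profile_apply, h]
  exact ⟨w, funext fun j => congrArg Prod.fst (congrFun hw j),
    funext fun j => congrArg Prod.snd (congrFun hw j)⟩

theorem exists_profile_eq (l : Fin k → ℕ →₀ ℕ) (hl : (∑ i, l i).degree = n) :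
    ∃ (f : Fin n → Fin k) (g : Fin n → ℕ), profile f g = l := by
  classical
  -- Take each pair `(i, m)` with multiplicity `l i m`; there are `n` items in total, so `[n]` can
  -- label them.
  have hcard : Fintype.card (Σ p : (Σ i : Fin k, (l i).support), Fin (l p.1 p.2)) =
      Fintype.card (Fin n) := by
    rw [Fintype.card_sigma, Fintype.card_fin, ← hl, map_sum, Fintype.sum_sigma]
    refine Finset.sum_congr rfl fun i _ => ?_
    simp only [Fintype.card_fin]
    rw [Finset.sum_coe_sort (l i).support (l i), Finsupp.degree_apply]
  let e := Fintype.equivOfCardEq hcard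
  refine ⟨fun j => (e.symm j).1.1, fun j => (e.symm j).1.2, funext fun i => Finsupp.ext fun m => ?_⟩
  rw [profile_apply, ← Fintype.card_subtype]
  by_cases hm : l i m = 0
  · rw [hm, Fintype.card_eq_zero_iff]
    refine ⟨fun j => ?_⟩
    obtain ⟨j, hj⟩ := j
    obtain ⟨rfl, rfl⟩ := Prod.mk.inj hj
    exact Finsupp.mem_support_iff.1 (e.symm j).1.2.2 hm
  · have hm' := Finsupp.mem_support_iff.2 hm
    rw [← Fintype.card_fin (l i m)]
    refine (Fintype.card_congr (Equiv.ofBijective (fun t => ⟨e ⟨⟨i, ⟨m, hm'⟩⟩, t⟩,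
        by rw [Equiv.symm_apply_apply]⟩)
      ⟨fun t t' h => ?_, fun j => ?_⟩)).symm
    · have h1 := e.injective (congrArg Subtype.val h)
      simpa using h1
    · obtain ⟨j, hj⟩ := j
      obtain ⟨x, rfl⟩ := e.surjective j
      have hx := hj
      rw [Equiv.symm_apply_apply] at hx
      obtain ⟨⟨i', m', h'⟩, t⟩ := x
      obtain ⟨rfl, rfl⟩ := Prod.mk.inj hx
      exact ⟨t, rfl⟩

end Profile

/-- The profile is a complete orbit invariant: it records how often each pair (block index, letter)
occurs. Nonempty blocks correspond to nonzero vectors. -/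
theorem card_orbits_eq_card_exponentSeq {n k : ℕ} {a : ℕ →₀ ℕ} (ha : a.degree = n) :
    Nat.card (MulAction.orbitRel.Quotient (Equiv.Perm (Fin n))
      (OrderedSetPartition n k × ContentFun n a)) = Nat.card (ExponentSeq k a) := by
  let P : OrderedSetPartition n k × ContentFun n a → ExponentSeq k a := fun x =>
    ⟨profile x.1.index x.2.1, (sum_profile _ _).trans x.2.2, profile_ne_zero x.1.index_surjective _⟩
  have hP : ∀ x y, P x = P y ↔ MulAction.orbitRel (Equiv.Perm (Fin n)) _ x y := by
    intro x y
    rw [MulAction.orbitRel_apply]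
    constructor
    · intro h
      obtain ⟨w, h1, h2⟩ := exists_perm_of_profile_eq (congrArg Subtype.val h)
      refine ⟨w⁻¹, Prod.ext (OrderedSetPartition.index_injective (funext fun j => ?_))
        (ContentFun.ext ?_)⟩
      · rw [← h1]
        exact (OrderedSetPartition.index_smul _ _ _).trans (by rw [inv_inv]; rfl)
      · rw [← h2]
        exact (ContentFun.smul_val _ _).trans (by rw [inv_inv])
    · rintro ⟨w, rfl⟩
      refine Subtype.ext ?_
      have h1 : (w • y.1).index = y.1.index ∘ (w⁻¹ : Equiv.Perm (Fin n)) :=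
        funext fun j => OrderedSetPartition.index_smul w y.1 j
      change profile (w • y.1).index (w • y.2).1 = profile y.1.index y.2.1
      rw [h1, ContentFun.smul_val, profile_comp_perm]
  refine Nat.card_congr (Equiv.ofBijective
    (Quotient.lift P fun x y h => (hP x y).2 h) ⟨?_, ?_⟩)
  · rintro ⟨x⟩ ⟨y⟩ h
    exact Quotient.sound ((hP x y).1 h)
  · rintro ⟨l, hl, hl0⟩
    obtain ⟨f, g, rfl⟩ := exists_profile_eq (n := n) l (by rw [hl, ha])
    have hf : Function.Surjective f := fun i => by
      by_contra! h
      refine hl0 i (Finsupp.ext fun m => ?_)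
      rw [profile_apply, Finsupp.zero_apply, Finset.card_eq_zero]
      ext j
      simp [h j]
    refine ⟨Quotient.mk _ (OrderedSetPartition.equivSurjective.symm ⟨f, hf⟩,
      ⟨g, by rw [← sum_profile f g, hl]⟩), Subtype.ext ?_⟩
    change profile (OrderedSetPartition.equivSurjective.symm ⟨f, hf⟩).index g = _
    rw [OrderedSetPartition.index_equivSurjective_symm]

theorem coeff_frob_ofMulAction (n k : ℕ) (a : ℕ →₀ ℕ) :
    MvPowerSeries.coeff a (frob (Representation.ofMulAction ℚ (Equiv.Perm (Fin n))
      (OrderedSetPartition n k))) = if a.degree = n then (Nat.card (ExponentSeq k a) : ℚ) else 0 := by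
  have h : MvPowerSeries.coeff a (frob (Representation.ofMulAction ℚ (Equiv.Perm (Fin n))
      (OrderedSetPartition n k))) = (Nat.card (MulAction.orbitRel.Quotient (Equiv.Perm (Fin n))
      (OrderedSetPartition n k × ContentFun n a)) : ℚ) := by
    have h1 := sum_card_fixedBy_mul_card_fixedBy (Equiv.Perm (Fin n)) (OrderedSetPartition n k)
      (ContentFun n a)
    rw [Fintype.card_perm, Fintype.card_fin] at h1
    rw [frob, map_smul, map_sum, smul_eq_mul, inv_mul_eq_iff_eq_mul₀ (by positivity), mul_comm,
      ← Nat.cast_mul, ← h1, Nat.cast_sum]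
    refine Finset.sum_congr rfl fun w _ => ?_
    rw [map_smul, smul_eq_mul, character_ofMulAction, coeff_powerSumCycle,
      ← card_fixedBy_contentFun, Nat.cast_mul]
  rw [h]
  split_ifs with ha
  · rw [card_orbits_eq_card_exponentSeq ha]
  · have : IsEmpty (ContentFun n a) := ⟨fun g => ha (by
      rw [← g.2, degree_content, Fintype.card_fin])⟩
    have : IsEmpty (MulAction.orbitRel.Quotient (Equiv.Perm (Fin n))
        (OrderedSetPartition n k × ContentFun n a)) := ⟨fun x => Quotient.inductionOn x isEmptyElim⟩
    simp

/-! ### Expansion in complete homogeneous functions. -/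

theorem coeff_completeHomogeneous (d : ℕ) (a : ℕ →₀ ℕ) :
    MvPowerSeries.coeff a (completeHomogeneous d) = if a.degree = d then 1 else 0 := rfl

theorem coeff_multiset_prod_completeHomogeneous (M : Multiset ℕ) (a : ℕ →₀ ℕ)
    (h : a.degree ≠ M.sum) :
    MvPowerSeries.coeff a (M.map completeHomogeneous).prod = 0 := by
  classical
  induction M using Multiset.induction generalizing a with
  | empty =>
    rw [Multiset.map_zero, Multiset.prod_zero, MvPowerSeries.coeff_one, if_neg]
    rintro rfl
    simp at h
  | cons d M ih =>
    rw [Multiset.map_cons, Multiset.prod_cons, MvPowerSeries.coeff_mul]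
    refine Finset.sum_eq_zero fun p hp => ?_
    rw [coeff_completeHomogeneous]
    split_ifs with hd
    · rw [ih, mul_zero]
      intro h1
      rw [← Finset.HasAntidiagonal.mem_antidiagonal.1 hp, map_add, hd, h1,
        Multiset.sum_cons] at h
      exact h rfl
    · rw [zero_mul]

theorem coeff_pow_sum_completeHomogeneous {n : ℕ} (k : ℕ) {a : ℕ →₀ ℕ} (ha : a.degree = n) :
    MvPowerSeries.coeff a ((∑ d ∈ Finset.Icc 1 n, completeHomogeneous d) ^ k) =
      (Nat.card (ExponentSeq k a) : ℚ) := by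
  classical
  -- On monomials dividing `x^a` the cutoff at degree `n` is invisible, so the sum acts as the
  -- series of all nonconstant monomials.
  have hH : ∀ m : ℕ →₀ ℕ, m ≤ a →
      MvPowerSeries.coeff m (∑ d ∈ Finset.Icc 1 n, completeHomogeneous d) =
        if m ≠ 0 then 1 else 0 := fun m hm => by
    simp only [map_sum, coeff_completeHomogeneous]
    rw [Finset.sum_ite_eq]
    congr 1
    have h1 : m.degree ≤ n := by
      rw [← ha, ← tsub_add_cancel_of_le hm, map_add]
      omega
    rw [Finset.mem_Icc, eq_iff_iff, Nat.one_le_iff_ne_zero, Ne, Finsupp.degree_eq_zero_iff]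
    simp [h1]
  have h1 : (∑ d ∈ Finset.Icc 1 n, completeHomogeneous d) ^ k =
      ∏ _i : Fin k, ∑ d ∈ Finset.Icc 1 n, completeHomogeneous d := by simp
  have h2 : Nat.card (ExponentSeq k a) = ((Finset.finsuppAntidiag Finset.univ a).filter
      fun l : Fin k →₀ (ℕ →₀ ℕ) => ∀ i, l i ≠ 0).card := by
    rw [← Nat.card_eq_finsetCard]
    exact Nat.card_congr
      { toFun := fun l => ⟨Finsupp.equivFunOnFinite.symm l.1, by
          simpa [Finset.mem_finsuppAntidiag] using l.2⟩
        invFun := fun l => ⟨l.1, by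
          have h := l.2
          rw [Finset.mem_filter, Finset.mem_finsuppAntidiag] at h
          exact ⟨h.1.1, h.2⟩⟩
        left_inv := fun l => rfl
        right_inv := fun l => by ext; rfl }
  rw [h1, MvPowerSeries.coeff_prod, h2, Finset.card_filter, Nat.cast_sum]
  refine Finset.sum_congr rfl fun l hl => ?_
  have h3 : ∀ i, l i ≤ a := fun i => by
    rw [← (Finset.mem_finsuppAntidiag.1 hl).1]
    exact Finset.single_le_sum (f := fun i => l i) (fun _ _ => zero_le) (Finset.mem_univ i)
  rw [Finset.prod_congr rfl fun i _ => hH (l i) (h3 i), Finset.prod_ite_zero]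
  simp

theorem factorial_div_prod_eq_countPerms {n k : ℕ} (M : Multiset ℕ) (hk : M.card = k)
    (hM : ∀ d ∈ M, d ∈ Finset.Icc 1 n) :
    (k ! : ℚ) / ∏ i ∈ Finset.Icc 1 n, ((M.count i)! : ℚ) = (M.countPerms : ℚ) := by
  have h1 : M.countPerms = Nat.multinomial (Finset.Icc 1 n) fun i => M.count i :=
    Finsupp.multinomial_eq_of_support_subset fun d hd => hM d (by simpa using hd)
  have h2 : ∑ i ∈ Finset.Icc 1 n, M.count i = k := by
    rw [← hk, Multiset.sum_count_eq_card hM]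
  have h3 := Nat.multinomial_spec (Finset.Icc 1 n) fun i => M.count i
  rw [h2, ← h1] at h3
  rw [← h3, div_eq_iff (Finset.prod_ne_zero_iff.2 fun i _ => by positivity)]
  push_cast
  ring

theorem coeff_sum_completeHomogeneousPart (n k : ℕ) (a : ℕ →₀ ℕ) :
    MvPowerSeries.coeff a (∑ μ : n.Partition with μ.parts.card = k,
      ((k ! : ℚ) / ∏ i ∈ Finset.Icc 1 n, ((μ.parts.count i)! : ℚ)) • completeHomogeneousPart μ) =
      if a.degree = n then (Nat.card (ExponentSeq k a) : ℚ) else 0 := by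
  classical
  rw [map_sum]
  split_ifs with ha
  · rw [← coeff_pow_sum_completeHomogeneous k ha, Finset.sum_pow, map_sum]
    have hIcc : ∀ μ : n.Partition, ∀ d ∈ μ.parts, d ∈ Finset.Icc 1 n := fun μ d hd =>
      Finset.mem_Icc.2 ⟨μ.parts_pos hd, μ.le_of_mem_parts hd⟩
    -- In the multinomial expansion only multisets of sum `n` reach degree `n`; these are the
    -- partitions of `n` with `k` parts.
    rw [← Finset.sum_filter_of_ne (p := fun M : Sym ℕ k => M.1.sum = n)]
    · refine Finset.sum_bij (fun μ hμ => (⟨μ.parts, (Finset.mem_filter.1 hμ).2⟩ : Sym ℕ k))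
        (fun μ hμ => ?_) (fun μ _ ν _ h => ?_) (fun M hM => ?_) (fun μ hμ => ?_)
      · exact Finset.mem_filter.2 ⟨Finset.mem_sym_iff.2 (hIcc μ), μ.parts_sum⟩
      · exact Nat.Partition.ext (congrArg Subtype.val h)
      · rw [Finset.mem_filter, Finset.mem_sym_iff] at hM
        exact ⟨⟨M.1, fun {d} hd => (Finset.mem_Icc.1 (hM.1 d hd)).1, hM.2⟩,
          Finset.mem_filter.2 ⟨Finset.mem_univ _, M.2⟩, rfl⟩
      · rw [factorial_div_prod_eq_countPerms μ.parts (Finset.mem_filter.1 hμ).2 (hIcc μ),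
          ← nsmul_eq_mul, map_nsmul, map_smul, ← Nat.cast_smul_eq_nsmul ℚ]
        rfl
    · intro M _ h
      by_contra h1
      refine h ?_
      rw [← nsmul_eq_mul, map_nsmul]
      rw [show MvPowerSeries.coeff a (M.val.map completeHomogeneous).prod = 0 from
        coeff_multiset_prod_completeHomogeneous _ _ (by rw [ha]; exact Ne.symm h1), smul_zero]
  · refine Finset.sum_eq_zero fun μ _ => ?_
    rw [map_smul, completeHomogeneousPart, coeff_multiset_prod_completeHomogeneous, smul_zero]
    rwa [μ.parts_sum]

theorem frob_congr {n : ℕ} {V W : Type*} [AddCommGroup V] [Module ℚ V] [AddCommGroup W] [Module ℚ W]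
    [FiniteDimensional ℚ V] [FiniteDimensional ℚ W] {ρ : Representation ℚ (Equiv.Perm (Fin n)) V}
    {σ : Representation ℚ (Equiv.Perm (Fin n)) W} (e : ρ.Equiv σ) : frob ρ = frob σ := by
  rw [frob, frob, Representation.char_iso e]

end GenCoinv

theorem mainTheorem5 (n k : ℕ) (hk : 1 ≤ k) (hkn : k ≤ n) :
    Nonempty (Representation.Equiv (GenCoinv.repR n k)
      (Representation.ofMulAction ℚ (Equiv.Perm (Fin n)) (GenCoinv.OrderedSetPartition n k))) ∧
    GenCoinv.frob (GenCoinv.repR n k) =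
      ∑ μ : n.Partition with μ.parts.card = k,
        ((k ! : ℚ) / ∏ i ∈ Finset.Icc 1 n, ((μ.parts.count i)! : ℚ)) •
          GenCoinv.completeHomogeneousPart μ := by
  obtain ⟨e⟩ := GenCoinv.nonempty_equiv_ofMulAction n k
  refine ⟨⟨e⟩, ?_⟩
  have : Module.Finite ℚ (GenCoinv.RingR n k) := (GenCoinv.finite_and_finrank_ringR_le n k).1
  have : Module.Finite ℚ (MonoidAlgebra ℚ (GenCoinv.OrderedSetPartition n k)) :=
    Module.Finite.equiv (MonoidAlgebra.coeffLinearEquiv ℚ).symm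
  rw [GenCoinv.frob_congr e]
  ext a
  rw [GenCoinv.coeff_frob_ofMulAction, GenCoinv.coeff_sum_completeHomogeneousPart]
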